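/- Let $k$ be an algebraically closed field, let $\Gamma=(\Gamma_0,\Gamma_1,s,e)$ be a finite acyclic quiver, and let $\mathcal A=(A_v)_{v\in\Gamma_0}$ be a family of finite-dimensional basic $k$-algebras, each presented as $A_v\cong k\Sigma_v/\Omega_v$ with $\Sigma_v$ a finite quiver and $\Omega_v$ an admissible ideal of the path algebra $k\Sigma_v$. A relation over $\Gamma$ is a $k$-linear combination of distinct paths of length at least two with a common starting vertex and a common ending vertex. Let $I$ be a set of relations over $\Gamma$ that generates an admissible ideal of $k\Gamma$. Let $k(\Gamma,\mathcal A)$ be the generalized path algebra: it is spanned by the $\mathcal A$-paths $a_1\beta_1a_2\cdots a_n\beta_na_{n+1}$ ($n\ge 0$, $\beta_1\cdots\beta_n$ a path of $\Gamma$, $a_j\in A_{s(\beta_j)}$ for $j\le n$ and $a_{n+1}\in A_{e(\beta_n)}$; for $n=0$, elements of the $A_v$), subject to $k$-linearity in each entry $a_j$, with $$(a_1\beta_1\cdots\beta_na_{n+1})(b_1\gamma_1\cdots\gamma_mb_{m+1})=a_1\beta_1\cdots\beta_n(a_{n+1}b_1)\gamma_1\cdots\gamma_mb_{m+1}$$ if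 the first $\mathcal A$-path ends at the vertex where the second one starts, and with product $0$ otherwise. Let $(\mathcal A(I))$ be its two-sided ideal generated by all elements $$\sum_{r}\lambda_r\,\beta_{r1}\overline{\gamma_{r1}}\beta_{r2}\overline{\gamma_{r2}}\cdots\overline{\gamma_{r(m_r-1)}}\beta_{rm_r},$$ where $\sum_r\lambda_r\beta_{r1}\cdots\beta_{rm_r}\in I$ and each $\gamma_{rj}$ is a path of $\Sigma_{e(\beta_{rj})}$ with class $\overline{\gamma_{rj}}\in A_{e(\beta_{rj})}$. Let $\Lambda=k(\Gamma,\mathcal A)/(\mathcal A(I))$ be the generalized bound path algebra, and let $A_{\mathcal A}=\prod_{v\in\Gamma_0}A_v$, with its canonical homomorphism $(a_v)_v\mapsto\sum_v\overline{a_v}$ to $\Lambda$. Write $\operatorname{mod}$ for the category of finitely generated right modules. Then, for every vertex $i\in\Gamma_0$, the cone functor $$\mathcal C_i:\operatorname{mod}A_i\to\operatorname{mod}\Lambda,\qquad \mathcal C_i(M)=M\otimes_{A_{\mathcal A}}\Lambda,$$ where $M$ is regarded as a right $A_{\mathcal A}$-module by $m\cdot(a_v)_v=m\,a_i$, is exact.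 -/

import Mathlib

open CategoryTheory TensorProduct MulOpposite

noncomputable section

namespace GBP

/-! ## The algebra of a category with finitely many objects -/

section CatAlg

universe u v w

/-- The `k`-vector space `⨁_{X, Y} k⟨C(X, Y)⟩` spanned by all morphisms of a small category `C` with
finitely many objects. Morphisms are multiplied by composition, in diagrammatic order (so
`p * q` is "first `p`, then `q`"), and `p * q = 0` if `p` and `q` are not composable. Here
`Free k C` is the category with the same objects as `C` and with
`Hom(X, Y) = k⟨C(X, Y)⟩`, the formal linear combinations of the morphisms from `X` to `Y`. -/
def CatAlg (k : Type u) [Field k] (C : Type v) [Category.{w} C] : Type (max u v w) :=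
  ∀ X Y : C, (Free.of k X ⟶ Free.of k Y)

variable (k : Type u) [Field k] (C : Type v) [Category.{w} C]

instance : AddCommGroup (CatAlg k C) :=
  inferInstanceAs (AddCommGroup (∀ X Y : C, (Free.of k X ⟶ Free.of k Y)))

instance : Module k (CatAlg k C) :=
  inferInstanceAs (Module k (∀ X Y : C, (Free.of k X ⟶ Free.of k Y)))

variable {k C}

/-- The inclusion of the linear combinations of morphisms `X ⟶ Y` into the category algebra. -/
def CatAlg.ofHom (X Y : C) : (Free.of k X ⟶ Free.of k Y) →ₗ[k] CatAlg k C :=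
  letI := Classical.decEq C
  (LinearMap.single k (fun X' : C => ∀ Y' : C, (Free.of k X' ⟶ Free.of k Y')) X).comp
    (LinearMap.single k (fun Y' : C => (Free.of k X ⟶ Free.of k Y')) Y)

variable (k) in
/-- A morphism of `C`, as a morphism of `Free k C`. -/
def freeHom {X Y : C} (p : X ⟶ Y) : Free.of k X ⟶ Free.of k Y :=
  (Finsupp.single p 1 : (X ⟶ Y) →₀ k)

/-- A morphism of `C`, as a basis element of the category algebra. -/
def CatAlg.of {X Y : C} (p : X ⟶ Y) : CatAlg k C :=
  CatAlg.ofHom X Y (freeHom k p)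

theorem freeHom_comp {X Y Z : C} (p : X ⟶ Y) (q : Y ⟶ Z) :
    freeHom k p ≫ freeHom k q = freeHom k (p ≫ q) := by
  refine (Free.single_comp_single k C p q 1 1).trans ?_
  rw [mul_one]
  rfl

theorem freeHom_id (X : C) : freeHom k (𝟙 X) = 𝟙 (Free.of k X) := rfl

theorem CatAlg.ext {f g : CatAlg k C} (h : ∀ X Y, f X Y = g X Y) : f = g :=
  funext fun X => funext fun Y => h X Y

theorem CatAlg.add_apply (f g : CatAlg k C) (X Y : C) : (f + g) X Y = f X Y + g X Y := rfl
theorem CatAlg.zero_apply (X Y : C) : (0 : CatAlg k C) X Y = 0 := rfl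
theorem CatAlg.smul_apply (c : k) (f : CatAlg k C) (X Y : C) : (c • f) X Y = c • f X Y := rfl

open scoped Classical in
instance : One (CatAlg k C) :=
  ⟨fun X Y => if h : X = Y then eqToHom (congrArg (Free.of k) h) else 0⟩

theorem CatAlg.one_apply_self (X : C) : (1 : CatAlg k C) X X = 𝟙 _ := by
  classical
  change (if h : X = X then eqToHom (congrArg (Free.of k) h) else 0) = _
  simp

theorem CatAlg.one_apply_ne {X Y : C} (h : X ≠ Y) : (1 : CatAlg k C) X Y = 0 := by
  classical
  change (if h : X = Y then eqToHom (congrArg (Free.of k) h) else 0) = _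
  simp [h]

theorem CatAlg.ofHom_apply_self (X Y : C) (f : Free.of k X ⟶ Free.of k Y) :
    (CatAlg.ofHom X Y f : CatAlg k C) X Y = f := by
  classical
  change (Pi.single X (Pi.single Y f :
    ∀ Y' : C, (Free.of k X ⟶ Free.of k Y')) : ∀ X' Y' : C, (Free.of k X' ⟶ Free.of k Y')) X Y = f
  convert congrFun (Pi.single_eq_same (M := fun X' : C => ∀ Y' : C, (Free.of k X' ⟶ Free.of k Y'))
    X (Pi.single Y f)) Y using 1
  exact (Pi.single_eq_same (M := fun Y' : C => (Free.of k X ⟶ Free.of k Y')) Y f).symm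

theorem CatAlg.ofHom_apply_ne {X Y X' Y' : C} (f : Free.of k X ⟶ Free.of k Y)
    (h : ¬ (X' = X ∧ Y' = Y)) : (CatAlg.ofHom X Y f : CatAlg k C) X' Y' = 0 := by
  classical
  change (Pi.single X (Pi.single Y f : ∀ Y' : C, (Free.of k X ⟶ Free.of k Y')) :
    ∀ X' Y' : C, (Free.of k X' ⟶ Free.of k Y')) X' Y' = 0
  by_cases hX : X' = X
  · subst hX
    refine (congrFun (Pi.single_eq_same
      (M := fun X' : C => ∀ Y' : C, (Free.of k X' ⟶ Free.of k Y')) X' (Pi.single Y f)) Y').trans ?_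
    exact Pi.single_eq_of_ne (fun hY => h ⟨rfl, hY⟩) f
  · exact congrFun (Pi.single_eq_of_ne (M := fun X' : C => ∀ Y' : C, (Free.of k X' ⟶ Free.of k Y'))
      hX (Pi.single Y f)) Y'

variable [Fintype C]

instance : Mul (CatAlg k C) := ⟨fun f g X Z => ∑ Y : C, f X Y ≫ g Y Z⟩

theorem CatAlg.mul_apply (f g : CatAlg k C) (X Z : C) :
    (f * g) X Z = ∑ Y : C, f X Y ≫ g Y Z := rfl

instance : Ring (CatAlg k C) :=
  { (inferInstance : AddCommGroup (CatAlg k C)), (inferInstance : Mul (CatAlg k C)),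
    (inferInstance : One (CatAlg k C)) with
    left_distrib := fun f g h => CatAlg.ext fun X Z => by
      simp [CatAlg.mul_apply, CatAlg.add_apply, Finset.sum_add_distrib]
    right_distrib := fun f g h => CatAlg.ext fun X Z => by
      simp [CatAlg.mul_apply, CatAlg.add_apply, Finset.sum_add_distrib]
    zero_mul := fun f => CatAlg.ext fun X Z => by
      simp [CatAlg.mul_apply, CatAlg.zero_apply]
    mul_zero := fun f => CatAlg.ext fun X Z => by
      simp [CatAlg.mul_apply, CatAlg.zero_apply]
    mul_assoc := fun f g h => CatAlg.ext fun X Z => by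
      simp only [CatAlg.mul_apply, Preadditive.sum_comp, Preadditive.comp_sum, Category.assoc]
      exact Finset.sum_comm
    one_mul := fun f => CatAlg.ext fun X Z => by
      rw [CatAlg.mul_apply, Finset.sum_eq_single X]
      · rw [CatAlg.one_apply_self, Category.id_comp]
      · intro Y _ h
        rw [CatAlg.one_apply_ne h.symm, Limits.zero_comp]
      · simp
    mul_one := fun f => CatAlg.ext fun X Z => by
      rw [CatAlg.mul_apply, Finset.sum_eq_single Z]
      · rw [CatAlg.one_apply_self, Category.comp_id]
      · intro Y _ h
        rw [CatAlg.one_apply_ne h, Limits.comp_zero]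
      · simp }

instance : Algebra k (CatAlg k C) :=
  Algebra.ofModule
    (fun c f g => CatAlg.ext fun X Z => by
      simp [CatAlg.mul_apply, CatAlg.smul_apply, Finset.smul_sum])
    (fun c f g => CatAlg.ext fun X Z => by
      simp [CatAlg.mul_apply, CatAlg.smul_apply, Finset.smul_sum])

/-- Composable morphisms multiply by composition. -/
theorem CatAlg.of_mul_of {X Y Z : C} (p : X ⟶ Y) (q : Y ⟶ Z) :
    (CatAlg.of p * CatAlg.of q : CatAlg k C) = CatAlg.of (p ≫ q) := by
  apply CatAlg.ext
  intro X' Z'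
  rw [CatAlg.mul_apply]
  simp only [CatAlg.of]
  by_cases h : X' = X ∧ Z' = Z
  · obtain ⟨rfl, rfl⟩ := h
    rw [Finset.sum_eq_single Y]
    · rw [CatAlg.ofHom_apply_self, CatAlg.ofHom_apply_self, CatAlg.ofHom_apply_self]
      exact freeHom_comp p q
    · intro Y' _ hY
      rw [CatAlg.ofHom_apply_ne _ (fun h => hY h.2), Limits.zero_comp]
    · simp
  · rw [CatAlg.ofHom_apply_ne _ h]
    refine Finset.sum_eq_zero fun Y' _ => ?_
    by_cases hX : X' = X
    · rw [CatAlg.ofHom_apply_ne (X := Y) _ (fun hh => h ⟨hX, hh.2⟩), Limits.comp_zero]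
    · rw [CatAlg.ofHom_apply_ne _ (fun hh => hX hh.1), Limits.zero_comp]

/-- Morphisms that are not composable have product zero. -/
theorem CatAlg.of_mul_of_ne {X Y Y' Z : C} (p : X ⟶ Y) (q : Y' ⟶ Z) (h : Y ≠ Y') :
    (CatAlg.of p * CatAlg.of q : CatAlg k C) = 0 := by
  apply CatAlg.ext
  intro X' Z'
  rw [CatAlg.mul_apply, CatAlg.zero_apply]
  refine Finset.sum_eq_zero fun W _ => ?_
  simp only [CatAlg.of]
  by_cases hW : W = Y
  · rw [CatAlg.ofHom_apply_ne (X := Y') _ (fun hh => h (hW.symm.trans hh.1)), Limits.comp_zero]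
  · rw [CatAlg.ofHom_apply_ne _ (fun hh => hW hh.2), Limits.zero_comp]

/-- The unit element is the sum of the identity morphisms. -/
theorem CatAlg.sum_of_id : (∑ X : C, CatAlg.of (𝟙 X) : CatAlg k C) = 1 := by
  apply CatAlg.ext
  intro X Y
  have key : (∑ W : C, CatAlg.of (𝟙 W) : CatAlg k C) X Y =
      ∑ W : C, (CatAlg.of (𝟙 W) : CatAlg k C) X Y := by
    rw [show (∑ W : C, CatAlg.of (𝟙 W) : CatAlg k C) X = ∑ W : C, (CatAlg.of (𝟙 W) : CatAlg k C) X
      from Finset.sum_apply X Finset.univ _]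
    exact Finset.sum_apply Y Finset.univ _
  rw [key, Finset.sum_eq_single X]
  · simp only [CatAlg.of]
    by_cases h : X = Y
    · subst h
      rw [CatAlg.ofHom_apply_self, CatAlg.one_apply_self, freeHom_id]
    · rw [CatAlg.ofHom_apply_ne _ (fun hh => h hh.2.symm), CatAlg.one_apply_ne h]
  · intro W _ hW
    exact CatAlg.ofHom_apply_ne _ (fun hh => hW hh.1.symm)
  · simp

end CatAlg

/-! ## Path algebras, admissible ideals, relations -/

section PathAlg

universe u v w

/-- The path algebra `kQ` of a quiver `Q` with finitely many vertices: the vector space spanned by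
the paths of `Q` (the morphisms of the free category on `Q`), multiplied by concatenation. -/
abbrev PathAlg (k : Type u) [Field k] (Q : Type v) [Quiver.{w} Q] : Type (max u v w) :=
  CatAlg k (Paths Q)

instance (Q : Type v) [Fintype Q] : Fintype (Paths Q) := inferInstanceAs (Fintype Q)

variable (k : Type u) [Field k] {Q : Type v} [Quiver.{w} Q]

/-- A path, as a basis element of the path algebra. -/
def pathElt {a b : Q} (p : Quiver.Path a b) : PathAlg k Q :=
  CatAlg.of (C := Paths Q) (X := a) (Y := b) p

variable (Q) in
/-- `R ^ m`, where `R` is the arrow ideal of `kQ`: the two-sided ideal generated by the paths of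
length `m`. -/
def arrowIdealPow [Fintype Q] (m : ℕ) : TwoSidedIdeal (PathAlg k Q) :=
  TwoSidedIdeal.span {x | ∃ (a b : Q) (p : Quiver.Path a b), p.length = m ∧ x = pathElt k p}

variable {k} in
/-- An ideal `J` of `kQ` is admissible if `R ^ m ⊆ J ⊆ R ^ 2` for some `m ≥ 2`, where `R` is the
arrow ideal. -/
def IsAdmissible [Fintype Q] (J : TwoSidedIdeal (PathAlg k Q)) : Prop :=
  J ≤ arrowIdealPow k Q 2 ∧ ∃ m, 2 ≤ m ∧ arrowIdealPow k Q m ≤ J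

variable (Q) in
/-- A relation over `Q`: a `k`-linear combination of (pairwise distinct) paths of length at least
two that all have the same starting vertex and the same ending vertex. -/
structure PathRel where
  /-- the common starting vertex -/
  source : Q
  /-- the common ending vertex -/
  target : Q
  /-- the linear combination of paths -/
  comb : Quiver.Path source target →₀ k
  two_le_length : ∀ p ∈ comb.support, 2 ≤ p.length

variable {k} in
/-- A relation, as an element of the path algebra. -/
def PathRel.elt (ρ : PathRel k Q) : PathAlg k Q :=
  ∑ p ∈ ρ.comb.support, ρ.comb p • pathElt k p

end PathAlg

/-! ## Generalized path algebras -/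

section GPA

universe u v w x

variable {V : Type v} [Quiver.{w} V]

/-- The `𝒜`-paths `a₁ β₁ a₂ … aₙ βₙ aₙ₊₁` over the quiver `V` with respect to the family
`𝒜 = (A v)_v`, where `β₁ … βₙ` is a path and the `aⱼ` are elements of the algebras at the vertices
that it passes. Those of length zero are the elements of the `A v`. -/
inductive APath (A : V → Type x) : V → V → Type (max v w x)
  | nil {i : V} (a : A i) : APath A i i
  | cons {i j l : V} (p : APath A i j) (β : j ⟶ l) (a : A l) : APath A i l

variable {A : V → Type x}

/-- Multiply the last entry of an `𝒜`-path by `b` on the right. -/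
def APath.mulLast [∀ v, Ring (A v)] {i j : V} : APath A i j → A j → APath A i j
  | .nil a, b => .nil (a * b)
  | .cons p β a, b => .cons p β (a * b)

/-- `(a₁ β₁ … βₙ aₙ₊₁) (b₁ γ₁ … γₘ bₘ₊₁) = a₁ β₁ … βₙ (aₙ₊₁ b₁) γ₁ … γₘ bₘ₊₁`. -/
def APath.comp [∀ v, Ring (A v)] {i j : V} :
    ∀ {l : V}, APath A i j → APath A j l → APath A i l
  | _, p, .nil b => p.mulLast b
  | _, p, .cons q γ b => .cons (p.comp q) γ b

/-- The vertices of the quiver, as the objects of the category of `𝒜`-paths. -/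
@[nolint unusedArguments]
def APathCat (_ : V → Type x) : Type v := V

instance [Fintype V] : Fintype (APathCat A) := inferInstanceAs (Fintype V)

theorem APath.one_comp [∀ v, Ring (A v)] {i j : V} (p : APath A i j) :
    (APath.nil (1 : A i)).comp p = p := by
  induction p with
  | nil a => simp [APath.comp, APath.mulLast]
  | cons p β a ih => simp [APath.comp, ih]

theorem APath.comp_one [∀ v, Ring (A v)] {i j : V} (p : APath A i j) :
    p.comp (APath.nil (1 : A j)) = p := by
  cases p <;> simp [APath.comp, APath.mulLast]

theorem APath.comp_assoc [∀ v, Ring (A v)] {i j l m : V} (p : APath A i j) (q : APath A j l)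
    (r : APath A l m) : (p.comp q).comp r = p.comp (q.comp r) := by
  induction r with
  | nil c => cases q <;> cases p <;> simp [APath.comp, APath.mulLast, mul_assoc]
  | cons r β a ih => simp [APath.comp, ih]

/-- `𝒜`-paths form a category under the multiplication of `𝒜`-paths. -/
instance [∀ v, Ring (A v)] : Category (APathCat A) where
  Hom i j := APath A i j
  id := fun i : V => (APath.nil (1 : A i) : APath A i i)
  comp p q := APath.comp p q
  id_comp p := APath.one_comp p
  comp_id p := APath.comp_one p
  assoc p q r := APath.comp_assoc p q r

variable (k : Type u) [Field k] [∀ v, Ring (A v)]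

variable (A) in
/-- `k[Γ, 𝒜]`, the vector space spanned by all `𝒜`-paths, with the multiplication of `𝒜`-paths
(which is zero on pairs of `𝒜`-paths that are not composable). -/
abbrev PreGPA : Type (max u v w x) := CatAlg k (APathCat A)

/-- An `𝒜`-path, as a basis element of `k[Γ, 𝒜]`. -/
def apathElt {i j : V} (p : APath A i j) : PreGPA A k :=
  CatAlg.of (C := APathCat A) (X := i) (Y := j) p

variable [Fintype V] [∀ v, Algebra k (A v)]

variable (A) in
/-- The space of multilinearity relations in `k[Γ, 𝒜]`. It is spanned by the products `p x q`,
where `p` and `q` are `𝒜`-paths and `x` is one of the two elements below; these products express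
that `𝒜`-paths are additive and `k`-homogeneous in each of their entries `aⱼ`. -/
def multilinearIdeal : TwoSidedIdeal (PreGPA A k) :=
  TwoSidedIdeal.span
    ({x | ∃ (v : V) (a b : A v), x = apathElt k (APath.nil (a + b)) -
        (apathElt k (APath.nil a) + apathElt k (APath.nil b))} ∪
      {x | ∃ (v : V) (c : k) (a : A v), x = apathElt k (APath.nil (c • a)) -
        c • apathElt k (APath.nil a)})

variable (A) in
/-- The generalized path algebra `k(Γ, 𝒜)`. -/
def GPA : Type (max u v w x) := (multilinearIdeal A k).ringCon.Quotient

instance : Ring (GPA A k) := inferInstanceAs (Ring (multilinearIdeal A k).ringCon.Quotient)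
instance : Algebra k (GPA A k) :=
  inferInstanceAs (Algebra k (multilinearIdeal A k).ringCon.Quotient)

variable (A) in
/-- The quotient map `k[Γ, 𝒜] → k(Γ, 𝒜)`. -/
def GPA.mk : PreGPA A k →ₐ[k] GPA A k := RingCon.mkₐ k (multilinearIdeal A k).ringCon

/-- An element `a` of the algebra at `v`, as an element of `k(Γ, 𝒜)`. -/
def GPA.vert {v : V} (a : A v) : GPA A k := GPA.mk A k (apathElt k (APath.nil a))

/-- An arrow `β`, as the element `1 β 1` of `k(Γ, 𝒜)`. -/
def GPA.arrow {v w : V} (β : v ⟶ w) : GPA A k :=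
  GPA.mk A k (apathElt k (APath.cons (APath.nil 1) β 1))

theorem GPA.mk_eq_zero {x : PreGPA A k} (h : x ∈ multilinearIdeal A k) : GPA.mk A k x = 0 := by
  rw [← map_zero (GPA.mk A k)]
  exact (RingCon.eq (multilinearIdeal A k).ringCon).2 ((TwoSidedIdeal.mem_iff _ _).1 h)

theorem GPA.vert_add {v : V} (a b : A v) :
    GPA.vert k (a + b) = GPA.vert k a + GPA.vert k b := by
  rw [← sub_eq_zero]
  simp only [GPA.vert, ← map_add, ← map_sub]
  exact GPA.mk_eq_zero k (TwoSidedIdeal.subset_span (Or.inl ⟨v, a, b, rfl⟩))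

theorem GPA.vert_smul {v : V} (c : k) (a : A v) :
    GPA.vert k (c • a) = c • GPA.vert k a := by
  rw [← sub_eq_zero]
  simp only [GPA.vert, ← map_smul, ← map_sub]
  exact GPA.mk_eq_zero k (TwoSidedIdeal.subset_span (Or.inr ⟨v, c, a, rfl⟩))

theorem GPA.vert_mul {v : V} (a b : A v) :
    GPA.vert k (a * b) = GPA.vert k a * GPA.vert k b := by
  simp only [GPA.vert, ← map_mul]
  exact congrArg (GPA.mk A k) (CatAlg.of_mul_of (k := k) (C := APathCat A) (X := v) (Y := v)
    (Z := v) (APath.nil a) (APath.nil b)).symm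

theorem GPA.vert_mul_ne {v w : V} (h : v ≠ w) (a : A v) (b : A w) :
    GPA.vert k a * GPA.vert k b = 0 := by
  simp only [GPA.vert, ← map_mul]
  exact (congrArg (GPA.mk A k) (CatAlg.of_mul_of_ne (k := k) (C := APathCat A) (X := v) (Y := v)
    (Y' := w) (Z := w) (APath.nil a) (APath.nil b) h)).trans (map_zero _)

theorem GPA.sum_vert_one : ∑ v : V, GPA.vert k (1 : A v) = 1 := by
  simp only [GPA.vert]
  rw [← map_sum, ← map_one (GPA.mk A k)]
  exact congrArg (GPA.mk A k) (CatAlg.sum_of_id (k := k) (C := APathCat A))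

variable (A) in
/-- The inclusion `(a_v)_v ↦ ∑ v, a_v` of the product algebra `A_𝒜 = ∏ v, A v` into
`k(Γ, 𝒜)`. -/
def GPA.incl : (∀ v, A v) →ₐ[k] GPA A k :=
  AlgHom.ofLinearMap
    { toFun := fun a => ∑ v : V, GPA.vert k (a v)
      map_add' := fun a b => by simp [GPA.vert_add, Finset.sum_add_distrib]
      map_smul' := fun c a => by simp [GPA.vert_smul, Finset.smul_sum] }
    (by simpa using GPA.sum_vert_one (A := A) k)
    (fun a b => by
      classical
      simp only [LinearMap.coe_mk, AddHom.coe_mk, Finset.sum_mul_sum, Pi.mul_apply, GPA.vert_mul]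
      refine Finset.sum_congr rfl fun v _ => ?_
      rw [Finset.sum_eq_single v]
      · intro w _ h
        exact GPA.vert_mul_ne k h.symm _ _
      · simp)

end GPA

/-! ## Generalized bound path algebras -/

section GBPA

universe u v w x y z

variable {k : Type u} [Field k] {V : Type v} [Fintype V] [Quiver.{w} V]
  {A : V → Type x} [∀ v, Ring (A v)] [∀ v, Algebra k (A v)]
  {S : V → Type y} [∀ v, Fintype (S v)] [∀ v, Quiver.{z} (S v)]
  (π : ∀ v, PathAlg k (S v) →ₐ[k] A v)

/-- `IsInterleaving π (β₁ … βₘ) x` says that `x ∈ k(Γ, 𝒜)` is of the form `β₁ γ₁ β₂ … γₘ₋₁ βₘ`,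
where each `γⱼ` is the class in `A v = kS_v / Ω_v` of a path of the quiver `S v`,
`v` being the ending vertex of `βⱼ`. -/
inductive IsInterleaving : ∀ {a b : V}, Quiver.Path a b → GPA A k → Prop
  | arrow {a b : V} (β : a ⟶ b) : IsInterleaving β.toPath (GPA.arrow k β)
  | cons {a b c : V} {p : Quiver.Path a b} {x : GPA A k} (hx : IsInterleaving p x)
      {s t : S b} (γ : Quiver.Path s t) (β : b ⟶ c) :
      IsInterleaving (p.cons β) (x * GPA.vert k (π b (pathElt k γ)) * GPA.arrow k β)

/-- The set `𝒜(I) ⊆ k(Γ, 𝒜)`: in a relation `∑ λ_p p` from `I`, each path `p` is replaced by some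
interleaving of `p`, chosen independently of the other summands. -/
def interleavedRelations (I : Set (PathRel k V)) : Set (GPA A k) :=
  {x | ∃ ρ ∈ I, ∃ f : Quiver.Path ρ.source ρ.target → GPA A k,
    (∀ p ∈ ρ.comb.support, IsInterleaving π p (f p)) ∧
      x = ∑ p ∈ ρ.comb.support, ρ.comb p • f p}

/-- The ideal `(𝒜(I))` of `k(Γ, 𝒜)` generated by `𝒜(I)`. -/
def gbpIdeal (I : Set (PathRel k V)) : TwoSidedIdeal (GPA A k) :=
  TwoSidedIdeal.span (interleavedRelations π I)

/-- The generalized bound path algebra `Λ = k(Γ, 𝒜, I) = k(Γ, 𝒜) / (𝒜(I))`. -/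
def GBPA (I : Set (PathRel k V)) : Type (max u v w x) := (gbpIdeal π I).ringCon.Quotient

variable (I : Set (PathRel k V))

instance : Ring (GBPA π I) := inferInstanceAs (Ring (gbpIdeal π I).ringCon.Quotient)
instance : Algebra k (GBPA π I) := inferInstanceAs (Algebra k (gbpIdeal π I).ringCon.Quotient)

/-- The quotient map `k(Γ, 𝒜) → Λ`. -/
def GBPA.mk : GPA A k →ₐ[k] GBPA π I := RingCon.mkₐ k (gbpIdeal π I).ringCon

/-- The canonical homomorphism `A_𝒜 = ∏ v, A v → Λ`. -/
def GBPA.incl : (∀ v, A v) →ₐ[k] GBPA π I := (GBPA.mk π I).comp (GPA.incl A k)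

end GBPA

/-! ## Extension of scalars over noncommutative rings, for right modules

Right `R`-modules are modules over the opposite ring `Rᵐᵒᵖ`. -/

section Extend

universe u v w

variable {R : Type u} {S : Type v} [Ring R] [Ring S] (f : R →+* S)

section

variable (M : Type w) [AddCommGroup M] [Module Rᵐᵒᵖ M]

/-- The relations `(m r) ⊗ s = m ⊗ (f r) s` of the tensor product `M ⊗_R S`. The elementary tensor
`m ⊗ s` is written `s ⊗ₜ m`, so that the right `S`-action is the one on the first factor. -/
def balancedRel : Submodule Sᵐᵒᵖ (S ⊗[ℤ] M) :=
  Submodule.span Sᵐᵒᵖ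
    {x | ∃ (s : S) (r : R) (m : M), x = s ⊗ₜ[ℤ] (op r • m) - (f r * s) ⊗ₜ[ℤ] m}

/-- The right `S`-module `M ⊗_R S`, for a right `R`-module `M` and a ring homomorphism
`f : R → S`, which makes `S` an `R`-`S`-bimodule. -/
abbrev ExtendScalars : Type (max v w) := (S ⊗[ℤ] M) ⧸ balancedRel f M

end

section

variable {M N : Type*} [AddCommGroup M] [Module Rᵐᵒᵖ M] [AddCommGroup N] [Module Rᵐᵒᵖ N]

/-- The elementary tensor `m ⊗ s` of `M ⊗_R S`. -/
def ExtendScalars.tmul (m : M) (s : S) : ExtendScalars f M :=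
  (balancedRel f M).mkQ (s ⊗ₜ[ℤ] m)

theorem ExtendScalars.smul_tmul (m : M) (r : R) (s : S) :
    ExtendScalars.tmul f (op r • m) s = ExtendScalars.tmul f m (f r * s) := by
  rw [← sub_eq_zero, ExtendScalars.tmul, ExtendScalars.tmul, ← map_sub]
  exact (Submodule.Quotient.mk_eq_zero _).2 (Submodule.subset_span ⟨s, r, m, rfl⟩)

theorem ExtendScalars.tmul_smul (m : M) (s t : S) :
    op t • ExtendScalars.tmul f m s = ExtendScalars.tmul f m (s * t) := rfl

/-- The map `g ⊗ id : M ⊗_R S → N ⊗_R S`. -/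
def ExtendScalars.map (g : M →ₗ[Rᵐᵒᵖ] N) : ExtendScalars f M →ₗ[Sᵐᵒᵖ] ExtendScalars f N :=
  Submodule.mapQ _ _ (AlgebraTensorModule.lTensor Sᵐᵒᵖ S g.toAddMonoidHom.toIntLinearMap) (by
    rw [balancedRel, Submodule.span_le]
    rintro _ ⟨s, r, m, rfl⟩
    refine Submodule.subset_span ⟨s, r, g m, ?_⟩
    simp)

@[simp]
theorem ExtendScalars.map_tmul (g : M →ₗ[Rᵐᵒᵖ] N) (m : M) (s : S) :
    ExtendScalars.map f g (ExtendScalars.tmul f m s) = ExtendScalars.tmul f (g m) s := rfl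

theorem ExtendScalars.hom_ext {P : Type*} [AddCommGroup P] [Module Sᵐᵒᵖ P]
    {g h : ExtendScalars f M →ₗ[Sᵐᵒᵖ] P}
    (H : ∀ m s, g (ExtendScalars.tmul f m s) = h (ExtendScalars.tmul f m s)) : g = h := by
  apply LinearMap.ext
  intro x
  obtain ⟨x, rfl⟩ := Submodule.mkQ_surjective _ x
  induction x using TensorProduct.induction_on with
  | zero => simp
  | tmul s m => exact H m s
  | add x y hx hy => rw [map_add, map_add, map_add, hx, hy]

theorem ExtendScalars.finite [Module.Finite Rᵐᵒᵖ M] :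
    Module.Finite Sᵐᵒᵖ (ExtendScalars f M) := by
  obtain ⟨T, hT⟩ := (Module.Finite.fg_top : (⊤ : Submodule Rᵐᵒᵖ M).FG)
  classical
  refine ⟨⟨T.image fun m => ExtendScalars.tmul f m 1, ?_⟩⟩
  rw [eq_top_iff]
  set X := Submodule.span Sᵐᵒᵖ
    ((T.image fun m => ExtendScalars.tmul f m 1 : Finset _) : Set (ExtendScalars f M)) with hX
  have h1 : ∀ (m : M) (s : S), ExtendScalars.tmul f m s ∈ X := by
    intro m
    have hm : m ∈ Submodule.span Rᵐᵒᵖ (T : Set M) := by rw [hT]; trivial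
    induction hm using Submodule.span_induction with
    | mem m hm =>
      intro s
      have := X.smul_mem (op s) (Submodule.subset_span
        (Finset.mem_coe.2 (Finset.mem_image_of_mem _ hm)) : ExtendScalars.tmul f m 1 ∈ X)
      rwa [ExtendScalars.tmul_smul, one_mul] at this
    | zero => intro s; simp [ExtendScalars.tmul]
    | add m n _ _ hm hn =>
      intro s
      have := X.add_mem (hm s) (hn s)
      rwa [ExtendScalars.tmul, ExtendScalars.tmul, ← map_add, ← TensorProduct.tmul_add] at this
    | smul r m _ hm =>
      intro s
      have := hm (f r.unop * s)
      rwa [← ExtendScalars.smul_tmul] at this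
  rintro x -
  obtain ⟨x, rfl⟩ := Submodule.mkQ_surjective _ x
  induction x using TensorProduct.induction_on with
  | zero => rw [map_zero]; exact X.zero_mem
  | tmul s m => exact h1 m s
  | add x y hx hy => rw [map_add]; exact X.add_mem hx hy

end

/-- The functor `- ⊗_R S` from right `R`-modules to right `S`-modules. -/
def extendScalarsFunctor : ModuleCat.{w} Rᵐᵒᵖ ⥤ ModuleCat.{max v w} Sᵐᵒᵖ where
  obj M := ModuleCat.of Sᵐᵒᵖ (ExtendScalars f M)
  map g := ModuleCat.ofHom (ExtendScalars.map f g.hom)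
  map_id M := by
    apply ModuleCat.hom_ext
    apply ExtendScalars.hom_ext
    intro m s
    rfl
  map_comp g h := by
    apply ModuleCat.hom_ext
    apply ExtendScalars.hom_ext
    intro m s
    rfl

end Extend

/-! ## Cones -/

section Cone

universe u v w x y z m

variable {k : Type u} [Field k] {V : Type v} [Fintype V] [Quiver.{w} V]
  {A : V → Type x} [∀ v, Ring (A v)] [∀ v, Algebra k (A v)]
  {S : V → Type y} [∀ v, Fintype (S v)] [∀ v, Quiver.{z} (S v)]
  (π : ∀ v, PathAlg k (S v) →ₐ[k] A v) (I : Set (PathRel k V)) (i : V)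

/-- The cone functor on all right `A i`-modules: a module `M` is regarded as an `A_𝒜`-module by
`m · (a_v)_v = m a_i`, and is sent to `M ⊗_{A_𝒜} Λ`. -/
def bigConeFunctor : ModuleCat.{m} (A i)ᵐᵒᵖ ⥤ ModuleCat.{max u v w x m} (GBPA π I)ᵐᵒᵖ :=
  ModuleCat.restrictScalars (RingHom.op (Pi.evalRingHom A i)) ⋙
    extendScalarsFunctor.{max v x, max u v w x, m} (GBPA.incl π I : (∀ v, A v) →+* GBPA π I)

theorem bigConeFunctor_isFG (M : ModuleCat.{m} (A i)ᵐᵒᵖ) (hM : ModuleCat.isFG _ M) :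
    ModuleCat.isFG _ ((bigConeFunctor π I i).obj M) := by
  have : Module.Finite (A i)ᵐᵒᵖ M := hM
  let g : (∀ v, A v)ᵐᵒᵖ →+* (A i)ᵐᵒᵖ := RingHom.op (Pi.evalRingHom A i)
  have hg : Function.Surjective g := fun a => by
    obtain ⟨b, hb⟩ := Function.surjective_eval i a.unop
    exact ⟨op b, congrArg op hb⟩
  let N := (ModuleCat.restrictScalars g).obj M
  have hN : Module.Finite (∀ v, A v)ᵐᵒᵖ N := by
    obtain ⟨T, hT⟩ := (Module.Finite.fg_top : (⊤ : Submodule (A i)ᵐᵒᵖ M).FG)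
    refine ⟨⟨T, ?_⟩⟩
    rw [eq_top_iff]
    rintro x -
    have hx : (x : M) ∈ Submodule.span (A i)ᵐᵒᵖ (T : Set M) := by rw [hT]; trivial
    induction hx using Submodule.span_induction with
    | mem x hx => exact Submodule.subset_span hx
    | zero => exact Submodule.zero_mem _
    | add x y _ _ hx hy => exact Submodule.add_mem _ hx hy
    | smul r x _ hx =>
      obtain ⟨r, rfl⟩ := hg r
      exact Submodule.smul_mem _ r hx
  exact ExtendScalars.finite (M := N) (GBPA.incl π I : (∀ v, A v) →+* GBPA π I)

/-- The cone functor `𝒞_i : mod A_i → mod Λ`, where `mod` stands for the category of finitely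
generated right modules. -/
def coneFunctor : FGModuleCat.{m} (A i)ᵐᵒᵖ ⥤ FGModuleCat.{max u v w x m} (GBPA π I)ᵐᵒᵖ :=
  (ModuleCat.isFG _).lift ((ModuleCat.isFG _).ι ⋙ bigConeFunctor π I i)
    (fun M => bigConeFunctor_isFG π I i M.obj M.property)

end Cone

end GBP

end

universe u v w x y z m

noncomputable section

namespace GBP

/-! ### Universal property of a category algebra -/

section Lift

variable {k : Type u} [Field k] {C : Type v} [Category.{w} C] [Fintype C]

/-! Write `R` for the product of the algebras `A v`. The point is that Λ is projective as a left
`R`-module. Concretely, the multiplication map μ from `R ⊗[k] Λ` to Λ has an `R`-linear section θ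
(`GBPA.exists_section`). Hence `M ⊗_R Λ` is, naturally in `M`, a retract of `M ⊗[k] Λ`. The latter
is exact in `M` because `k` is a field, and a natural retract of an exact functor is exact
(`ExtendScalars.map_exact`).

On 𝒜-paths the section is a₁β₁a₂⋯ ↦ a₁ ⊗ β₁a₂⋯, and a ↦ a ⊗ 1 in length zero. It respects the
relations because every path in a relation starts with an arrow at the common source, and no entry
is interleaved before that arrow. To avoid checking well-definedness on a whole two-sided ideal, θ
is read off from a representation of Λ on Λ × (R ⊗ Λ): vertex elements multiply both factors on the
left, and an arrow β out of v sends (y, t) to (βy, e_v ⊗ βy). An interleaving x of a path from a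
then acts by (y, t) ↦ (xy, e_a ⊗ xy) (`IsInterleaving.gpaAction_apply`), which depends linearly on
the class of x in Λ, so the generators of the ideal act as zero. Finally, θ(s) is the second
coordinate of s · (1, 1 ⊗ 1).

Exactness on all modules gives preservation of finite limits and colimits; this descends to finitely
generated modules through the full inclusions. -/

theorem CatAlg.sum_apply₂ {ι : Type*} (s : Finset ι) (f : ι → CatAlg k C) (X Y : C) :
    (∑ j ∈ s, f j) X Y = ∑ j ∈ s, f j X Y := by
  rw [show (∑ j ∈ s, f j) X = ∑ j ∈ s, f j X from Finset.sum_apply X s _]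
  exact Finset.sum_apply Y s _

theorem CatAlg.sum_ofHom (x : CatAlg k C) : ∑ X : C, ∑ Y : C, CatAlg.ofHom X Y (x X Y) = x := by
  apply CatAlg.ext
  intro X Y
  simp only [CatAlg.sum_apply₂]
  rw [Finset.sum_eq_single X, Finset.sum_eq_single Y, CatAlg.ofHom_apply_self]
  · exact fun Y' _ h => CatAlg.ofHom_apply_ne _ fun hh => h hh.2.symm
  · simp
  · exact fun X' _ h => Finset.sum_eq_zero fun Y' _ =>
      CatAlg.ofHom_apply_ne _ fun hh => h hh.1.symm
  · simp

/-- The morphisms of the category span its category algebra. -/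
theorem CatAlg.span_of :
    Submodule.span k {x : CatAlg k C | ∃ (X Y : C) (p : X ⟶ Y), x = CatAlg.of p} = ⊤ := by
  rw [eq_top_iff]
  rintro x -
  rw [← CatAlg.sum_ofHom x]
  refine Submodule.sum_mem _ fun X _ => Submodule.sum_mem _ fun Y _ => ?_
  generalize x X Y = f
  -- Hom-spaces of `Free k C` are by definition finitely supported functions on morphisms.
  change (X ⟶ Y) →₀ k at f
  induction f using Finsupp.induction_linear with
  | zero => exact (CatAlg.ofHom X Y : _ →ₗ[k] CatAlg k C).map_zero ▸ Submodule.zero_mem _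
  | add f g hf hg =>
    exact ((CatAlg.ofHom X Y : _ →ₗ[k] CatAlg k C).map_add f g).symm ▸ Submodule.add_mem _ hf hg
  | single p c =>
    have h : (Finsupp.single p c : (X ⟶ Y) →₀ k) = c • Finsupp.single p (1 : k) := by simp
    rw [h]
    exact ((CatAlg.ofHom X Y : _ →ₗ[k] CatAlg k C).map_smul c (freeHom k p)).symm ▸
      Submodule.smul_mem _ c (Submodule.subset_span ⟨X, Y, p, rfl⟩)

variable {E : Type*}

/-- A family of vectors indexed by the morphisms extends linearly to the category algebra. -/
def CatAlg.linearLift [AddCommGroup E] [Module k E] (F : ∀ X Y : C, (X ⟶ Y) → E) :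
    CatAlg k C →ₗ[k] E where
  toFun x := ∑ X : C, ∑ Y : C, Finsupp.linearCombination k (F X Y) (x X Y)
  map_add' x y := by
    simp only [← Finset.sum_add_distrib]
    exact Finset.sum_congr rfl fun X _ => Finset.sum_congr rfl fun Y _ => map_add _ _ _
  map_smul' c x := by
    simp only [Finset.smul_sum]
    exact Finset.sum_congr rfl fun X _ => Finset.sum_congr rfl fun Y _ =>
      (Finsupp.linearCombination k (F X Y)).map_smul c (x X Y)

theorem CatAlg.linearLift_of [AddCommGroup E] [Module k E] (F : ∀ X Y : C, (X ⟶ Y) → E)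
    {X Y : C} (p : X ⟶ Y) : CatAlg.linearLift F (CatAlg.of p : CatAlg k C) = F X Y p := by
  change ∑ X' : C, ∑ Y' : C, Finsupp.linearCombination k (F X' Y')
    ((CatAlg.of p : CatAlg k C) X' Y') = _
  have h0 : ∀ X' Y' : C, ¬ (X' = X ∧ Y' = Y) → Finsupp.linearCombination k (F X' Y')
      ((CatAlg.of p : CatAlg k C) X' Y') = 0 := fun X' Y' h =>
    (congrArg (Finsupp.linearCombination k (F X' Y')) (CatAlg.ofHom_apply_ne _ h)).trans
      (map_zero _)
  rw [Finset.sum_eq_single X, Finset.sum_eq_single Y]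
  · refine (congrArg (Finsupp.linearCombination k (F X Y))
      (CatAlg.ofHom_apply_self X Y (freeHom k p))).trans ?_
    exact (Finsupp.linearCombination_single k 1 p).trans (one_smul _ _)
  · exact fun Y' _ h => h0 _ _ fun hh => h hh.2
  · simp
  · exact fun X' _ h => Finset.sum_eq_zero fun Y' _ => h0 _ _ fun hh => h hh.1
  · simp

/-- The universal property of the category algebra. -/
def CatAlg.lift [Ring E] [Algebra k E] (F : ∀ X Y : C, (X ⟶ Y) → E)
    (hmul : ∀ {X Y Z : C} (p : X ⟶ Y) (q : Y ⟶ Z), F X Z (p ≫ q) = F X Y p * F Y Z q)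
    (hne : ∀ {X Y Y' Z : C} (p : X ⟶ Y) (q : Y' ⟶ Z), Y ≠ Y' → F X Y p * F Y' Z q = 0)
    (hone : ∑ X : C, F X X (𝟙 X) = 1) : CatAlg k C →ₐ[k] E :=
  AlgHom.ofLinearMap (CatAlg.linearLift (k := k) F)
    (by
      rw [← CatAlg.sum_of_id (k := k) (C := C), map_sum, ← hone]
      exact Finset.sum_congr rfl fun X _ => CatAlg.linearLift_of (k := k) (C := C) F (𝟙 X))
    (by
      intro x y
      have hx : x ∈ Submodule.span k {x : CatAlg k C | ∃ (X Y : C) (p : X ⟶ Y), x = CatAlg.of p} :=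
        CatAlg.span_of (k := k) (C := C) ▸ Submodule.mem_top
      have hy : y ∈ Submodule.span k {x : CatAlg k C | ∃ (X Y : C) (p : X ⟶ Y), x = CatAlg.of p} :=
        CatAlg.span_of (k := k) (C := C) ▸ Submodule.mem_top
      induction hx, hy using Submodule.span_induction₂ with
      | mem_mem x y hx hy =>
        obtain ⟨X, Y, p, rfl⟩ := hx
        obtain ⟨Y', Z, q, rfl⟩ := hy
        by_cases h : Y = Y'
        · subst h
          rw [CatAlg.of_mul_of]
          simp only [CatAlg.linearLift_of, hmul]
        · rw [CatAlg.of_mul_of_ne p q h]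
          simp only [CatAlg.linearLift_of, hne p q h, map_zero]
      | zero_left y _ => simp
      | zero_right x _ => simp
      | add_left x y z _ _ _ h1 h2 => rw [add_mul, map_add, h1, h2, map_add, add_mul]
      | add_right x y z _ _ _ h1 h2 => rw [mul_add, map_add, h1, h2, map_add, mul_add]
      | smul_left r x y _ _ h => rw [smul_mul_assoc, map_smul, h, map_smul, smul_mul_assoc]
      | smul_right r x y _ _ h => rw [mul_smul_comm, map_smul, h, map_smul, mul_smul_comm])

theorem CatAlg.lift_of [Ring E] [Algebra k E] (F : ∀ X Y : C, (X ⟶ Y) → E)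
    (hmul : ∀ {X Y Z : C} (p : X ⟶ Y) (q : Y ⟶ Z), F X Z (p ≫ q) = F X Y p * F Y Z q)
    (hne : ∀ {X Y Y' Z : C} (p : X ⟶ Y) (q : Y' ⟶ Z), Y ≠ Y' → F X Y p * F Y' Z q = 0)
    (hone : ∑ X : C, F X X (𝟙 X) = 1) {X Y : C} (p : X ⟶ Y) :
    CatAlg.lift F hmul hne hone (CatAlg.of p : CatAlg k C) = F X Y p :=
  CatAlg.linearLift_of F p

end Lift

/-- Lets an algebra map descend to a quotient by a generated two-sided ideal after a check on
generators only. Used for both quotients, k(Γ, 𝒜) and Λ. -/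
theorem ringCon_span_le_ker {k R S : Type*} [CommSemiring k] [Ring R] [Ring S] [Algebra k R]
    [Algebra k S] (X : Set R) (f : R →ₐ[k] S) (h : ∀ x ∈ X, f x = 0) :
    (TwoSidedIdeal.span X).ringCon ≤ RingCon.ker f.toRingHom := by
  intro x y hxy
  have hle : TwoSidedIdeal.span X ≤ TwoSidedIdeal.ker f :=
    TwoSidedIdeal.span_le.2 fun x hx => (TwoSidedIdeal.mem_ker f).2 (h x hx)
  have h0 := (TwoSidedIdeal.mem_ker f).1 (hle ((TwoSidedIdeal.rel_iff _ x y).1 hxy))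
  rw [map_sub, sub_eq_zero] at h0
  exact h0

/-! ### Factorization of 𝒜-paths in k(Γ, 𝒜) -/

section GPA

variable {k : Type u} [Field k] {V : Type v} [Fintype V] [Quiver.{w} V]
  {A : V → Type x} [∀ v, Ring (A v)] [∀ v, Algebra k (A v)]

/-- The units that are the outer entries of `GPA.arrow` are absorbed by their neighbours. This
factorization drives the inductions along 𝒜-paths. -/
theorem GPA.mk_apathElt_cons {i j l : V} (p : APath A i j) (β : j ⟶ l) (a : A l) :
    GPA.mk A k (apathElt k (p.cons β a)) =
      GPA.mk A k (apathElt k p) * (GPA.arrow k β * GPA.vert k a) := by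
  simp only [GPA.arrow, GPA.vert, ← map_mul]
  refine congrArg (GPA.mk A k) ?_
  have h1 : (apathElt k (APath.cons (APath.nil (1 : A j)) β 1) * apathElt k (APath.nil a) :
      PreGPA A k) = apathElt k (APath.cons (APath.nil 1) β a) := by
    refine (CatAlg.of_mul_of (k := k) (C := APathCat A) (X := j) (Y := l) (Z := l) _ _).trans ?_
    exact congrArg (apathElt (A := A) k (i := j) (j := l))
      (by simp [CategoryStruct.comp, APath.comp, APath.mulLast])
  rw [h1]
  refine Eq.symm ((CatAlg.of_mul_of (k := k) (C := APathCat A) (X := i) (Y := j) (Z := l)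
    _ _).trans ?_)
  refine congrArg (apathElt (A := A) k (i := i) (j := l)) ?_
  change APath.cons (p.comp (APath.nil 1)) β a = _
  rw [APath.comp_one]

theorem GPA.vert_mul_arrow {v w : V} (β : v ⟶ w) :
    GPA.vert k (1 : A v) * GPA.arrow k β = GPA.arrow k β := by
  have h : GPA.arrow k β = GPA.vert k (1 : A v) * (GPA.arrow k β * GPA.vert k (1 : A w)) :=
    GPA.mk_apathElt_cons (APath.nil 1) β 1
  rw [h, ← mul_assoc, ← GPA.vert_mul, one_mul]

theorem GPA.arrow_mul_vert {v w : V} (β : v ⟶ w) :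
    GPA.arrow k β * GPA.vert k (1 : A w) = GPA.arrow k β := by
  have h : GPA.arrow k β = GPA.vert k (1 : A v) * (GPA.arrow k β * GPA.vert k (1 : A w)) :=
    GPA.mk_apathElt_cons (APath.nil 1) β 1
  rw [h, mul_assoc, mul_assoc, ← GPA.vert_mul, one_mul]

theorem GPA.mk_surjective : Function.Surjective (GPA.mk A k) :=
  (multilinearIdeal A k).ringCon.mk'_surjective

theorem GPA.incl_single [DecidableEq V] (v : V) (a : A v) :
    GPA.incl A k (Pi.single v a) = GPA.vert k a := by
  change ∑ w : V, GPA.vert k ((Pi.single v a : ∀ v, A v) w) = _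
  rw [Finset.sum_eq_single v]
  · simp
  · intro w _ h
    rw [Pi.single_eq_of_ne h]
    -- That `GPA.vert` kills 0 is the case of scalar 0 of homogeneity.
    simpa using GPA.vert_smul k (0 : k) (0 : A w)
  · simp

/-- `k(Γ, 𝒜)` is spanned by the `𝒜`-paths. -/
theorem GPA.span_apathElt :
    Submodule.span k {x : GPA A k | ∃ (i j : V) (p : APath A i j),
      x = GPA.mk A k (apathElt k p)} = ⊤ := by
  have h := congrArg (Submodule.map (GPA.mk A k).toLinearMap)
    (CatAlg.span_of (k := k) (C := APathCat A))
  rw [Submodule.map_span, Submodule.map_top, LinearMap.range_eq_top.2 GPA.mk_surjective] at h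
  rw [eq_top_iff, ← h]
  refine Submodule.span_mono ?_
  rintro _ ⟨_, ⟨X, Y, p, rfl⟩, rfl⟩
  exact ⟨X, Y, p, rfl⟩

end GPA

/-! ### The representation on Λ × (A_𝒜 ⊗ Λ) and the section of multiplication -/

section Splitting

variable {k : Type u} [Field k] {V : Type v} [Fintype V] [Quiver.{w} V]
  {A : V → Type x} [∀ v, Ring (A v)] [∀ v, Algebra k (A v)]
  {B : Type*} [Ring B] [Algebra k B] (φ : GPA A k →ₐ[k] B)

/-- The space `B × (A_𝒜 ⊗ B)`, on which `k(Γ, 𝒜)` acts for every algebra homomorphism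
`k(Γ, 𝒜) → B`. -/
abbrev SplitSpace (_ : GPA A k →ₐ[k] B) : Type _ := B × ((∀ v, A v) ⊗[k] B)

/-- The action of `A_𝒜` on `B × (A_𝒜 ⊗ B)`. -/
def vertexAction : (∀ v, A v) →ₐ[k] Module.End k (SplitSpace φ) :=
  (LinearMap.prodMapAlgHom k B ((∀ v, A v) ⊗[k] B)).comp
    (((Algebra.lmul k B).comp (φ.comp (GPA.incl A k))).prod
      (Algebra.lsmul k k ((∀ v, A v) ⊗[k] B)))

theorem vertexAction_apply (r : ∀ v, A v) (z : SplitSpace φ) :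
    vertexAction φ r z = (φ (GPA.incl A k r) * z.1, r • z.2) := rfl

/-- The multiplication map `A_𝒜 ⊗ B → B`. -/
def multMap : (∀ v, A v) ⊗[k] B →ₗ[k] B :=
  LinearMap.mul' k B ∘ₗ LinearMap.rTensor B (φ.comp (GPA.incl A k)).toLinearMap

theorem multMap_tmul (r : ∀ v, A v) (b : B) :
    multMap φ (r ⊗ₜ b) = φ (GPA.incl A k r) * b := rfl

theorem multMap_smul (r : ∀ v, A v) (t : (∀ v, A v) ⊗[k] B) :
    multMap φ (r • t) = φ (GPA.incl A k r) * multMap φ t := by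
  induction t with
  | zero => simp
  | add s t hs ht => rw [smul_add, map_add, hs, ht, map_add, mul_add]
  | tmul s b => rw [smul_tmul', multMap_tmul, multMap_tmul, smul_eq_mul, map_mul, map_mul, mul_assoc]

variable [DecidableEq V]

/-- The action of an arrow `β : v ⟶ w` on `B × (A_𝒜 ⊗ B)`. It sends `(y, t)` to
`(β y, e_v ⊗ β y)`. -/
def arrowAction {v w : V} (β : v ⟶ w) : Module.End k (SplitSpace φ) :=
  (LinearMap.prod LinearMap.id (TensorProduct.mk k (∀ v, A v) B (Pi.single v 1))) ∘ₗ
    (LinearMap.mulLeft k (φ (GPA.arrow k β))) ∘ₗ LinearMap.fst k _ _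

theorem arrowAction_apply {v w : V} (β : v ⟶ w) (z : SplitSpace φ) :
    arrowAction φ β z = (φ (GPA.arrow k β) * z.1,
      (Pi.single v 1 : ∀ v, A v) ⊗ₜ (φ (GPA.arrow k β) * z.1)) := rfl

/-- The action of an `𝒜`-path on `B × (A_𝒜 ⊗ B)`. -/
def apathAction : ∀ {i j : V}, APath A i j → Module.End k (SplitSpace φ)
  | i, _, .nil a => vertexAction φ (Pi.single i a)
  | _, l, .cons p β a => apathAction p * (arrowAction φ β * vertexAction φ (Pi.single l a))

theorem apathAction_mulLast {i j : V} (p : APath A i j) (b : A j) :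
    apathAction φ (p.mulLast b) = apathAction φ p * vertexAction φ (Pi.single j b) := by
  cases p <;> simp [APath.mulLast, apathAction, Pi.single_mul, mul_assoc]

theorem apathAction_comp {i j l : V} (p : APath A i j) (q : APath A j l) :
    apathAction φ (p.comp q) = apathAction φ p * apathAction φ q := by
  induction q with
  | nil b => rw [apathAction, APath.comp, apathAction_mulLast]
  | cons q β a ih => simp only [APath.comp, apathAction, ih, mul_assoc]

/-- Between the two actions one may insert the idempotents of the vertices `j` and `j'`, which are
orthogonal. -/
theorem apathAction_mul_of_ne {i j j' l : V} (p : APath A i j) (q : APath A j' l) (h : j ≠ j') :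
    apathAction φ p * apathAction φ q = 0 := by
  rw [← APath.comp_one p, ← APath.one_comp q, apathAction_comp, apathAction_comp, mul_assoc,
    ← mul_assoc (apathAction φ (APath.nil 1))]
  have : apathAction φ (APath.nil (1 : A j)) * apathAction φ (APath.nil (1 : A j')) = 0 := by
    simp only [apathAction, ← map_mul]
    rw [show (Pi.single j 1 * Pi.single j' 1 : ∀ v, A v) = 0 from ?_, map_zero]
    ext v
    by_cases hv : v = j
    · subst hv; simp [h]
    · simp [hv]
  rw [this, zero_mul, mul_zero]

theorem sum_apathAction_nil_one :
    ∑ v : V, apathAction φ (APath.nil (1 : A v)) = 1 := by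
  simp only [apathAction, ← map_sum]
  rw [show ∑ v : V, (Pi.single v 1 : ∀ v, A v) = 1 from Finset.univ_sum_single 1, map_one]

/-- The action of `k[Γ, 𝒜]` on `B × (A_𝒜 ⊗ B)`. -/
def preAction : PreGPA A k →ₐ[k] Module.End k (SplitSpace φ) :=
  CatAlg.lift (C := APathCat A) (fun X Y (p : APath A X Y) => apathAction φ p)
    (fun p q => apathAction_comp φ p q) (fun p q h => apathAction_mul_of_ne φ p q h)
    (sum_apathAction_nil_one φ)

theorem preAction_apathElt {i j : V} (p : APath A i j) :
    preAction φ (apathElt k p) = apathAction φ p :=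
  CatAlg.lift_of (C := APathCat A) _ _ _ _ _

/-- The action of `k(Γ, 𝒜)` on `B × (A_𝒜 ⊗ B)`. -/
def gpaAction : GPA A k →ₐ[k] Module.End k (SplitSpace φ) :=
  (multilinearIdeal A k).ringCon.liftₐ (preAction φ) (by
    -- The generators involve only 𝒜-paths of length zero, so linearity of the vertex action
    -- suffices.
    refine ringCon_span_le_ker (S := Module.End k (SplitSpace φ)) _ (preAction φ) ?_
    rintro _ (⟨v, a, b, rfl⟩ | ⟨v, c, a, rfl⟩)
    · simp [preAction_apathElt, apathAction, Pi.single_add]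
    · simp [preAction_apathElt, apathAction, Pi.single_smul])

theorem gpaAction_apathElt {i j : V} (p : APath A i j) :
    gpaAction φ (GPA.mk A k (apathElt k p)) = apathAction φ p :=
  preAction_apathElt φ p

theorem gpaAction_vert {v : V} (a : A v) :
    gpaAction φ (GPA.vert k a) = vertexAction φ (Pi.single v a) := by
  rw [GPA.vert, gpaAction_apathElt, apathAction]

/-- As an 𝒜-path the arrow is 1β1, so two idempotents act along with it. They disappear because e_v
β = β = β e_w and e_v · (e_v ⊗ y) = e_v ⊗ y. -/
theorem gpaAction_arrow {v w : V} (β : v ⟶ w) :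
    gpaAction φ (GPA.arrow k β) = arrowAction φ β := by
  refine (gpaAction_apathElt φ _).trans (LinearMap.ext fun z => ?_)
  simp only [apathAction, Module.End.mul_apply, vertexAction_apply, arrowAction_apply,
    GPA.incl_single, smul_tmul', smul_eq_mul, ← Pi.single_mul, mul_one]
  simp only [← mul_assoc, ← map_mul, GPA.vert_mul_arrow, GPA.arrow_mul_vert]

theorem gpaAction_incl (r : ∀ v, A v) : gpaAction φ (GPA.incl A k r) = vertexAction φ r := by
  change gpaAction φ (∑ v : V, GPA.vert k (r v)) = _
  simp only [map_sum, gpaAction_vert]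
  rw [← map_sum, Finset.univ_sum_single]

/-- No generator lets the tensor coordinate influence the first one, so projection to `B` is
equivariant. -/
theorem gpaAction_fst (g : GPA A k) (z : SplitSpace φ) : (gpaAction φ g z).1 = φ g * z.1 := by
  have hg : g ∈ Submodule.span k {x : GPA A k | ∃ (i j : V) (p : APath A i j),
      x = GPA.mk A k (apathElt k p)} := GPA.span_apathElt (k := k) (A := A) ▸ Submodule.mem_top
  induction hg using Submodule.span_induction generalizing z with
  | mem g hg =>
    obtain ⟨i, j, p, rfl⟩ := hg
    rw [gpaAction_apathElt]
    induction p generalizing z with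
    | nil a => rw [apathAction, vertexAction_apply, GPA.incl_single]; rfl
    | cons p β a ih =>
      rw [apathAction, Module.End.mul_apply, ih, GPA.mk_apathElt_cons]
      simp [arrowAction_apply, vertexAction_apply, GPA.incl_single, mul_assoc]
  | zero => simp
  | add g h _ _ ihg ihh => simp [ihg, ihh, add_mul]
  | smul c g _ ih => simp [ih]

/-- The vectors whose second coordinate multiplies out to the first form an invariant subspace.
Vertex elements preserve it since `multMap` is A_𝒜-linear; an arrow even sends every vector into it,
since e_v β = β. -/
theorem multMap_gpaAction (g : GPA A k) (z : SplitSpace φ) (hz : multMap φ z.2 = z.1) :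
    multMap φ (gpaAction φ g z).2 = φ g * z.1 := by
  rw [← gpaAction_fst]
  have hg : g ∈ Submodule.span k {x : GPA A k | ∃ (i j : V) (p : APath A i j),
      x = GPA.mk A k (apathElt k p)} := GPA.span_apathElt (k := k) (A := A) ▸ Submodule.mem_top
  induction hg using Submodule.span_induction with
  | mem g hg =>
    obtain ⟨i, j, p, rfl⟩ := hg
    rw [gpaAction_apathElt]
    have hv : ∀ (r : ∀ v, A v) (z : SplitSpace φ), multMap φ z.2 = z.1 →
        multMap φ (vertexAction φ r z).2 = (vertexAction φ r z).1 := fun r z hz => by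
      rw [vertexAction_apply, multMap_smul, hz]
    induction p generalizing z with
    | nil a => rw [apathAction]; exact hv _ _ hz
    | cons p β a ih =>
      rw [apathAction]
      refine ih _ ?_
      rw [Module.End.mul_apply, arrowAction_apply, multMap_tmul, GPA.incl_single, ← mul_assoc,
        ← map_mul, GPA.vert_mul_arrow]
  | zero => simp
  | add g h _ _ ihg ihh => simp [ihg, ihh]
  | smul c g _ ih => simp [ih]

variable {S : V → Type y} [∀ v, Fintype (S v)] [∀ v, Quiver.{z} (S v)]
  (π : ∀ v, PathAlg k (S v) →ₐ[k] A v) (I : Set (PathRel k V))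

/-- In a product, the left factor `x` reads only the first coordinate of what γβ produces. So the
tensor coordinate remembers just the source of the leading arrow. -/
theorem IsInterleaving.gpaAction_apply {π : ∀ v, PathAlg k (S v) →ₐ[k] A v} {a b : V}
    {p : Quiver.Path a b} {x : GPA A k} (hx : IsInterleaving π p x) (z : SplitSpace φ) :
    gpaAction φ x z = (φ x * z.1, (Pi.single a 1 : ∀ v, A v) ⊗ₜ (φ x * z.1)) := by
  induction hx generalizing z with
  | arrow β => rw [gpaAction_arrow, arrowAction_apply]
  | @cons b c p x hx s t γ β ih =>
    rw [mul_assoc, map_mul, Module.End.mul_apply, ih, gpaAction_fst, map_mul φ x, mul_assoc (φ x)]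

/-- The action of `Λ` on `Λ × (A_𝒜 ⊗ Λ)`. -/
def gbpaAction : GBPA π I →ₐ[k] Module.End k (SplitSpace (GBPA.mk π I)) :=
  (gbpIdeal π I).ringCon.liftₐ (gpaAction (GBPA.mk π I)) (by
    refine ringCon_span_le_ker (S := Module.End k (SplitSpace (GBPA.mk π I))) _
      (gpaAction (GBPA.mk π I)) ?_
    rintro x ⟨ρ, hρ, f, hf, rfl⟩
    have h0 : GBPA.mk π I (∑ p ∈ ρ.comb.support, ρ.comb p • f p) = 0 := by
      rw [← map_zero (GBPA.mk π I)]
      exact (RingCon.eq (gbpIdeal π I).ringCon).2 ((TwoSidedIdeal.mem_iff _ _).1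
        (TwoSidedIdeal.subset_span ⟨ρ, hρ, f, hf, rfl⟩))
    refine LinearMap.ext fun z => ?_
    -- All paths of a relation share one source, so the same idempotent stands in front of every
    -- summand. The sum thus acts through its class in Λ, which is 0 by `h0`.
    have h1 : gpaAction (GBPA.mk π I) (∑ p ∈ ρ.comb.support, ρ.comb p • f p) z =
        LinearMap.prod LinearMap.id (TensorProduct.mk k (∀ v, A v) (GBPA π I)
          (Pi.single ρ.source 1))
          (GBPA.mk π I (∑ p ∈ ρ.comb.support, ρ.comb p • f p) * z.1) := by
      simp only [map_sum, Finset.sum_mul, LinearMap.sum_apply, map_smul, smul_mul_assoc,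
        LinearMap.smul_apply]
      exact Finset.sum_congr rfl fun p hp =>
        congrArg (ρ.comb p • ·) ((hf p hp).gpaAction_apply _ z)
    rw [h1, h0, zero_mul, map_zero]
    rfl)

theorem gbpaAction_mk (g : GPA A k) :
    gbpaAction π I (GBPA.mk π I g) = gpaAction (GBPA.mk π I) g := rfl

/-- The generalized bound path algebra is a projective left module over `A_𝒜`: the multiplication
map `A_𝒜 ⊗ Λ → Λ` has an `A_𝒜`-linear section. -/
theorem GBPA.exists_section : ∃ θ : GBPA π I →ₗ[k] (∀ v, A v) ⊗[k] GBPA π I,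
    (∀ r s, θ (GBPA.incl π I r * s) = r • θ s) ∧
      ∀ s, LinearMap.mul' k (GBPA π I)
        (LinearMap.rTensor (GBPA π I) (GBPA.incl π I).toLinearMap (θ s)) = s := by
  -- Evaluate the action at (1, 1 ⊗ 1), a vector of the invariant subspace of `multMap_gpaAction`,
  -- and keep the tensor coordinate. Linearity over A_𝒜 holds because vertex elements act on that
  -- coordinate by left multiplication.
  refine ⟨LinearMap.snd k _ _ ∘ₗ
    LinearMap.applyₗ ((1, 1 ⊗ₜ 1) : SplitSpace (GBPA.mk π I)) ∘ₗ (gbpaAction π I).toLinearMap,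
    fun r s => ?_, fun s => ?_⟩
  · change (gbpaAction π I (GBPA.mk π I (GPA.incl A k r) * s) _).2 = _
    rw [map_mul, Module.End.mul_apply, gbpaAction_mk, gpaAction_incl]
    rfl
  · obtain ⟨g, rfl⟩ := (gbpIdeal π I).ringCon.mk'_surjective s
    refine (multMap_gpaAction (GBPA.mk π I) g (1, 1 ⊗ₜ 1) ?_).trans (mul_one _)
    rw [multMap_tmul, map_one, map_one, one_mul]

end Splitting

/-! ### Elementary tensors and balanced maps -/

section ExtendScalars

variable {R S : Type*} [Ring R] [Ring S] (f : R →+* S) {M P : Type*} [AddCommGroup M]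
  [Module Rᵐᵒᵖ M] [AddCommGroup P]

theorem ExtendScalars.tmul_add (m : M) (s t : S) :
    ExtendScalars.tmul f m (s + t) = ExtendScalars.tmul f m s + ExtendScalars.tmul f m t :=
  (congrArg (balancedRel f M).mkQ (TensorProduct.add_tmul s t m)).trans (map_add _ _ _)

theorem ExtendScalars.add_tmul (m n : M) (s : S) :
    ExtendScalars.tmul f (m + n) s = ExtendScalars.tmul f m s + ExtendScalars.tmul f n s :=
  (congrArg (balancedRel f M).mkQ (TensorProduct.tmul_add s m n)).trans (map_add _ _ _)

theorem ExtendScalars.tmul_zero (m : M) : ExtendScalars.tmul f m 0 = 0 :=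
  (congrArg (balancedRel f M).mkQ (TensorProduct.zero_tmul S m)).trans (map_zero _)

theorem ExtendScalars.zero_tmul (s : S) : ExtendScalars.tmul f (0 : M) s = 0 :=
  (congrArg (balancedRel f M).mkQ (TensorProduct.tmul_zero M s)).trans (map_zero _)

variable {f} in
theorem ExtendScalars.addHom_ext {g h : ExtendScalars f M →+ P}
    (H : ∀ m s, g (ExtendScalars.tmul f m s) = h (ExtendScalars.tmul f m s)) : g = h := by
  ext x
  obtain ⟨x, rfl⟩ := Submodule.mkQ_surjective _ x
  induction x using TensorProduct.induction_on with
  | zero => simp only [map_zero]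
  | tmul s m => exact H m s
  | add x y hx hy => rw [map_add, map_add, map_add, hx, hy]

variable {f} in
/-- A balanced additive map vanishes on the relations of the tensor product. -/
theorem map_eq_zero_of_mem_balancedRel (g : S ⊗[ℤ] M →+ P)
    (H : ∀ s r m, g (s ⊗ₜ (op r • m)) = g ((f r * s) ⊗ₜ m)) {x : S ⊗[ℤ] M}
    (hx : x ∈ balancedRel f M) : g x = 0 := by
  -- The relations form an `S`-submodule but `g` is only additive, so the induction must treat all
  -- multiples `t • x` at once.
  rw [← one_smul Sᵐᵒᵖ x]
  generalize (1 : Sᵐᵒᵖ) = t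
  rw [balancedRel] at hx
  induction hx using Submodule.span_induction generalizing t with
  | mem x hx =>
    obtain ⟨s, r, m, rfl⟩ := hx
    rw [smul_sub, smul_tmul', smul_tmul', map_sub, sub_eq_zero, H, MulOpposite.smul_eq_mul_unop,
      MulOpposite.smul_eq_mul_unop, mul_assoc]
  | zero => rw [smul_zero, map_zero]
  | add x y _ _ hx hy => rw [smul_add, map_add, hx, hy, add_zero]
  | smul a x _ hx => rw [smul_smul, hx]

end ExtendScalars

/-! ### `M ⊗_R S` as a natural retract of `M ⊗_k S` -/

section Retract

variable {k R S : Type*} [Field k] [Ring R] [Ring S] [Algebra k R] [Algebra k S] (f : R →ₐ[k] S)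
  (θ : S →ₗ[k] R ⊗[k] S)
  {M N : Type*} [AddCommGroup M] [Module Rᵐᵒᵖ M] [Module k M] [IsScalarTower k Rᵐᵒᵖ M]
  [AddCommGroup N] [Module Rᵐᵒᵖ N] [Module k N] [IsScalarTower k Rᵐᵒᵖ N]

variable (k R M) in
/-- The action map of a right module, `m ↦ r ↦ m r`. -/
def rightAction : M →ₗ[k] R →ₗ[k] M :=
  LinearMap.mk₂ k (fun m r => op r • m) (fun _ _ _ => smul_add _ _ _)
    (fun c m r => (smul_comm c (op r) m).symm) (fun m r s => add_smul (op r) (op s) m)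
    (fun c m r => smul_assoc c (op r) m)

theorem rightAction_apply (m : M) (r : R) : rightAction k R M m r = op r • m := rfl

/-- This is (mr)a = m(ra). With the `R`-linearity of θ it makes m ⊗ s ↦ m · θ(s) balanced over `R`.
-/
theorem rTensor_rightAction_smul (m : M) (r : R) (t : R ⊗[k] S) :
    LinearMap.rTensor S (rightAction k R M (op r • m)) t =
      LinearMap.rTensor S (rightAction k R M m) (r • t) := by
  induction t with
  | zero => simp
  | add s t hs ht => rw [smul_add, map_add, hs, ht, map_add]
  | tmul a s =>
    rw [smul_tmul', LinearMap.rTensor_tmul, LinearMap.rTensor_tmul, rightAction_apply,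
      rightAction_apply, smul_smul, smul_eq_mul, op_mul]

theorem rTensor_rightAction_map (g : M →ₗ[Rᵐᵒᵖ] N) (m : M) (t : R ⊗[k] S) :
    LinearMap.rTensor S (g.restrictScalars k) (LinearMap.rTensor S (rightAction k R M m) t) =
      LinearMap.rTensor S (rightAction k R N (g m)) t := by
  induction t with
  | zero => simp
  | add s t hs ht => simp only [map_add, hs, ht]
  | tmul a s => simp [rightAction_apply]

variable (M) in
/-- The additive map `M ⊗_R S → M ⊗_k S` induced by an `R`-linear map `S → R ⊗_k S`. -/
def ExtendScalars.toTensor (hθ : ∀ r s, θ (f r * s) = r • θ s) :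
    ExtendScalars f.toRingHom M →+ M ⊗[k] S :=
  QuotientAddGroup.lift (balancedRel f.toRingHom M).toAddSubgroup
    (TensorProduct.lift (LinearMap.mk₂ ℤ
      (fun (s : S) (m : M) => LinearMap.rTensor S (rightAction k R M m) (θ s))
      (fun s t m => by simp only [map_add])
      (fun c s m => by simp only [map_zsmul])
      (fun s m n => by simp only [map_add, LinearMap.rTensor_add, LinearMap.add_apply])
      (fun c s m => by
        change LinearMap.rTensorHom S (rightAction k R M (c • m)) (θ s) =
          c • LinearMap.rTensorHom S (rightAction k R M m) (θ s)
        simp only [map_zsmul, LinearMap.smul_apply]))).toAddMonoidHom (by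
    refine fun x hx => map_eq_zero_of_mem_balancedRel _ (fun s r m => ?_) hx
    change LinearMap.rTensor S (rightAction k R M (op r • m)) (θ s) =
      LinearMap.rTensor S (rightAction k R M m) (θ (f r * s))
    rw [rTensor_rightAction_smul, hθ])

theorem ExtendScalars.toTensor_tmul (hθ : ∀ r s, θ (f r * s) = r • θ s) (m : M) (s : S) :
    ExtendScalars.toTensor f θ M hθ (ExtendScalars.tmul f.toRingHom m s) =
      LinearMap.rTensor S (rightAction k R M m) (θ s) := rfl

variable (M) in
/-- The canonical map `M ⊗_k S → M ⊗_R S`. -/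
def ExtendScalars.ofTensor : M ⊗[k] S →+ ExtendScalars f.toRingHom M :=
  TensorProduct.liftAddHom
    (AddMonoidHom.mk' (fun m => AddMonoidHom.mk' (fun s => ExtendScalars.tmul f.toRingHom m s)
      (ExtendScalars.tmul_add _ m)) (fun m n => AddMonoidHom.ext (ExtendScalars.add_tmul _ m n)))
    (fun c m s => by
      change ExtendScalars.tmul f.toRingHom (c • m) s = ExtendScalars.tmul f.toRingHom m (c • s)
      have h1 : c • m = op (algebraMap k R c) • m := by
        rw [← algebraMap_smul Rᵐᵒᵖ c m]; rfl
      rw [h1, ExtendScalars.smul_tmul, Algebra.smul_def]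
      exact congrArg (fun a => ExtendScalars.tmul f.toRingHom m (a * s)) (f.commutes c))

theorem ExtendScalars.ofTensor_tmul (m : M) (s : S) :
    ExtendScalars.ofTensor f M (m ⊗ₜ s) = ExtendScalars.tmul f.toRingHom m s := rfl

theorem ExtendScalars.ofTensor_rTensor_rightAction (m : M) (t : R ⊗[k] S) :
    ExtendScalars.ofTensor f M (LinearMap.rTensor S (rightAction k R M m) t) =
      ExtendScalars.tmul f.toRingHom m
        (LinearMap.mul' k S (LinearMap.rTensor S f.toLinearMap t)) := by
  induction t with
  | zero => simp only [map_zero, ExtendScalars.tmul_zero]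
  | add s t hs ht => simp only [map_add, hs, ht, ExtendScalars.tmul_add]
  | tmul a s =>
    rw [LinearMap.rTensor_tmul, ExtendScalars.ofTensor_tmul, rightAction_apply,
      ExtendScalars.smul_tmul]
    rfl

/-- Moving the `R`-factors of θ(s) back across the tensor sign turns m · θ(s) into m ⊗ μ(θ(s)) = m ⊗
s. -/
theorem ExtendScalars.ofTensor_toTensor (hθ : ∀ r s, θ (f r * s) = r • θ s)
    (hμ : ∀ s, LinearMap.mul' k S (LinearMap.rTensor S f.toLinearMap (θ s)) = s)
    (x : ExtendScalars f.toRingHom M) :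
    ExtendScalars.ofTensor f M (ExtendScalars.toTensor f θ M hθ x) = x := by
  have h : (ExtendScalars.ofTensor f M).comp (ExtendScalars.toTensor f θ M hθ) =
      AddMonoidHom.id _ := by
    refine ExtendScalars.addHom_ext fun m s => ?_
    rw [AddMonoidHom.comp_apply, ExtendScalars.toTensor_tmul,
      ExtendScalars.ofTensor_rTensor_rightAction, hμ]
    rfl
  exact DFunLike.congr_fun h x

/-- Together with `ExtendScalars.ofTensor_rTensor`, this makes the retraction natural, so that
exactness can be transferred along it. -/
theorem ExtendScalars.toTensor_map (hθ : ∀ r s, θ (f r * s) = r • θ s) (g : M →ₗ[Rᵐᵒᵖ] N)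
    (x : ExtendScalars f.toRingHom M) :
    ExtendScalars.toTensor f θ N hθ (ExtendScalars.map f.toRingHom g x) =
      LinearMap.rTensor S (g.restrictScalars k) (ExtendScalars.toTensor f θ M hθ x) := by
  have h : (ExtendScalars.toTensor f θ N hθ).comp
        (ExtendScalars.map f.toRingHom g).toAddMonoidHom =
      (LinearMap.rTensor S (g.restrictScalars k)).toAddMonoidHom.comp
        (ExtendScalars.toTensor f θ M hθ) := by
    refine ExtendScalars.addHom_ext fun m s => ?_
    exact (rTensor_rightAction_map g m (θ s)).symm
  exact DFunLike.congr_fun h x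

theorem ExtendScalars.ofTensor_rTensor (g : M →ₗ[Rᵐᵒᵖ] N) (t : M ⊗[k] S) :
    ExtendScalars.ofTensor f N (LinearMap.rTensor S (g.restrictScalars k) t) =
      ExtendScalars.map f.toRingHom g (ExtendScalars.ofTensor f M t) := by
  induction t with
  | zero => simp only [map_zero]
  | add s t hs ht => simp only [map_add, hs, ht]
  | tmul m s => rfl

end Retract

/-- If the multiplication map `R ⊗_k S → S` has an `R`-linear section, then `- ⊗_R S` preserves
exact sequences. -/
theorem ExtendScalars.map_exact {k R S : Type*} [Field k] [Ring R] [Ring S] [Algebra k R]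
    [Algebra k S] (f : R →ₐ[k] S) (θ : S →ₗ[k] R ⊗[k] S) (hθ : ∀ r s, θ (f r * s) = r • θ s)
    (hμ : ∀ s, LinearMap.mul' k S (LinearMap.rTensor S f.toLinearMap (θ s)) = s)
    {L M N : Type*} [AddCommGroup L] [Module Rᵐᵒᵖ L] [AddCommGroup M] [Module Rᵐᵒᵖ M]
    [AddCommGroup N] [Module Rᵐᵒᵖ N] (g : L →ₗ[Rᵐᵒᵖ] M) (h : M →ₗ[Rᵐᵒᵖ] N)
    (hgh : Function.Exact g h) :
    Function.Exact (ExtendScalars.map f.toRingHom g) (ExtendScalars.map f.toRingHom h) := by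
  -- The modules carry only an `R`-action; `k` acts through its image in `R`.
  let _ : Module k L := Module.compHom L (algebraMap k Rᵐᵒᵖ)
  let _ : Module k M := Module.compHom M (algebraMap k Rᵐᵒᵖ)
  let _ : Module k N := Module.compHom N (algebraMap k Rᵐᵒᵖ)
  have _ : IsScalarTower k Rᵐᵒᵖ L := IsScalarTower.of_algebraMap_smul fun _ _ => rfl
  have _ : IsScalarTower k Rᵐᵒᵖ M := IsScalarTower.of_algebraMap_smul fun _ _ => rfl
  have _ : IsScalarTower k Rᵐᵒᵖ N := IsScalarTower.of_algebraMap_smul fun _ _ => rfl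
  have hex : Function.Exact (LinearMap.rTensor S (g.restrictScalars k))
      (LinearMap.rTensor S (h.restrictScalars k)) := Module.Flat.rTensor_exact S hgh
  intro y
  constructor
  · intro hy
    -- Push `y` into `M ⊗_k S`, lift it there by flatness over the field, and bring the lift back by
    -- the retraction.
    obtain ⟨t, ht⟩ := (hex (ExtendScalars.toTensor f θ M hθ y)).1 (by
      rw [← ExtendScalars.toTensor_map, hy, map_zero])
    exact ⟨ExtendScalars.ofTensor f L t, by
      rw [← ExtendScalars.ofTensor_rTensor, ht, ExtendScalars.ofTensor_toTensor f θ hθ hμ]⟩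
  · rintro ⟨x, rfl⟩
    have h0 : (ExtendScalars.map f.toRingHom h).comp (ExtendScalars.map f.toRingHom g) = 0 := by
      refine ExtendScalars.hom_ext _ fun m s => ?_
      change ExtendScalars.tmul f.toRingHom (h (g m)) s = 0
      rw [hgh.apply_apply_eq_zero, ExtendScalars.zero_tmul]
    exact LinearMap.congr_fun h0 x

/-! ### Exactness of the cone functor -/

section Cone

open Limits

variable {k : Type u} [Field k] {V : Type v} [Fintype V] [Quiver.{w} V]
  {A : V → Type x} [∀ v, Ring (A v)] [∀ v, Algebra k (A v)]
  {S : V → Type y} [∀ v, Fintype (S v)] [∀ v, Quiver.{z} (S v)]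
  (π : ∀ v, PathAlg k (S v) →ₐ[k] A v) (I : Set (PathRel k V)) (i : V)

theorem bigConeFunctor_map_exact {L M N : ModuleCat.{m} (A i)ᵐᵒᵖ} (f : L ⟶ M) (g : M ⟶ N)
    (h : Function.Exact f.hom g.hom) :
    Function.Exact ((bigConeFunctor π I i).map f).hom ((bigConeFunctor π I i).map g).hom := by
  classical
  obtain ⟨θ, hθ, hμ⟩ := GBPA.exists_section π I
  exact ExtendScalars.map_exact (GBPA.incl π I) θ hθ hμ
    ((ModuleCat.restrictScalars (RingHom.op (Pi.evalRingHom A i))).map f).hom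
    ((ModuleCat.restrictScalars (RingHom.op (Pi.evalRingHom A i))).map g).hom h

instance bigConeFunctor_additive : (bigConeFunctor.{u, v, w, x, y, z, m} π I i).Additive where
  map_add {M N f g} := by
    apply ModuleCat.hom_ext
    apply ExtendScalars.hom_ext
    intro m s
    exact ExtendScalars.add_tmul
      (M := (ModuleCat.restrictScalars (RingHom.op (Pi.evalRingHom A i))).obj N) _ (f.hom m) (g.hom m) s

theorem bigConeFunctor_preservesFinite :
    PreservesFiniteLimits (bigConeFunctor.{u, v, w, x, y, z, m} π I i) ∧
      PreservesFiniteColimits (bigConeFunctor.{u, v, w, x, y, z, m} π I i) := by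
  -- For an additive functor of abelian categories, preserving exact three-term complexes is
  -- equivalent to preserving finite limits and colimits.
  refine ((Functor.exact_tfae (bigConeFunctor.{u, v, w, x, y, z, m} π I i)).out 1 3).1 ?_
  intro T hT
  exact (ShortComplex.ShortExact.moduleCat_exact_iff_function_exact _).2
    (bigConeFunctor_map_exact π I i T.f T.g
      ((ShortComplex.ShortExact.moduleCat_exact_iff_function_exact _).1 hT))

/-- The cone functor on finitely generated modules is exact. -/
theorem coneFunctor_exact [IsNoetherianRing (A i)ᵐᵒᵖ] :
    exactFunctor (FGModuleCat.{m} (A i)ᵐᵒᵖ) (FGModuleCat (GBPA π I)ᵐᵒᵖ)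
      (coneFunctor.{u, v, w, x, y, z, m} π I i) := by
  obtain ⟨h₁, h₂⟩ := bigConeFunctor_preservesFinite.{u, v, w, x, y, z, m} π I i
  -- Over a Noetherian ring submodules of finitely generated modules are finitely generated, so
  -- kernels agree with those among all modules.
  have hl : PreservesFiniteLimits (ModuleCat.isFG.{m} (A i)ᵐᵒᵖ).ι :=
    inferInstanceAs (PreservesFiniteLimits (forget₂ (FGModuleCat (A i)ᵐᵒᵖ) (ModuleCat (A i)ᵐᵒᵖ)))
  have hr : PreservesFiniteColimits (ModuleCat.isFG.{m} (A i)ᵐᵒᵖ).ι :=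
    inferInstanceAs (PreservesFiniteColimits
      (forget₂ (FGModuleCat (A i)ᵐᵒᵖ) (ModuleCat (A i)ᵐᵒᵖ)))
  have hl' : PreservesFiniteLimits (coneFunctor.{u, v, w, x, y, z, m} π I i ⋙
      (ModuleCat.isFG _).ι) :=
    inferInstanceAs (PreservesFiniteLimits ((ModuleCat.isFG _).ι ⋙ bigConeFunctor π I i))
  have hr' : PreservesFiniteColimits (coneFunctor.{u, v, w, x, y, z, m} π I i ⋙
      (ModuleCat.isFG _).ι) :=
    inferInstanceAs (PreservesFiniteColimits ((ModuleCat.isFG _).ι ⋙ bigConeFunctor π I i))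
  -- On the side of Λ the inclusion only has to reflect limits and colimits, which full faithfulness
  -- gives; Λ need not be Noetherian.
  exact ⟨⟨fun J _ _ => preservesLimitsOfShape_of_reflects_of_preserves _ (ModuleCat.isFG _).ι⟩,
    ⟨fun J _ _ => preservesColimitsOfShape_of_reflects_of_preserves _ (ModuleCat.isFG _).ι⟩⟩

end Cone

end GBP

end

theorem proposition4p4
    -- the algebraically closed ground field
    {k : Type u} [Field k] [IsAlgClosed k]
    -- the finite acyclic quiver with vertex set `V`
    {V : Type v} [Fintype V] [Quiver.{w} V] [∀ a b : V, Finite (a ⟶ b)]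
    (acyclic : ∀ (a : V) (p : Quiver.Path a a), p = Quiver.Path.nil)
    -- the finite-dimensional algebras `A v`, presented as `kS_v / Ω_v` with `S v` a finite quiver
    -- and `Ω_v = ker (π v)` an admissible ideal
    {A : V → Type x} [∀ v, Ring (A v)] [∀ v, Algebra k (A v)] [∀ v, FiniteDimensional k (A v)]
    {S : V → Type y} [∀ v, Fintype (S v)] [∀ v, Quiver.{z} (S v)]
    [∀ (v : V) (a b : S v), Finite (a ⟶ b)]
    (π : ∀ v, GBP.PathAlg k (S v) →ₐ[k] A v)
    (surjective : ∀ v, Function.Surjective (π v))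
    (admissible : ∀ v, GBP.IsAdmissible (TwoSidedIdeal.ker (π v)))
    -- the relations on `V`, which generate an admissible ideal of the path algebra
    (I : Set (GBP.PathRel k V))
    (admissible_I : GBP.IsAdmissible (TwoSidedIdeal.span (GBP.PathRel.elt '' I)))
    (i : V) :
    -- the cone functor is exact, that is, it preserves finite limits and finite colimits
    exactFunctor (FGModuleCat.{m} (A i)ᵐᵒᵖ) (FGModuleCat (GBP.GBPA π I)ᵐᵒᵖ)
      (GBP.coneFunctor.{u, v, w, x, y, z, m} π I i) ∧
    -- equivalently, it takes exact sequences `L → M → N` to exact sequences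
    ∀ (L M N : FGModuleCat.{m} (A i)ᵐᵒᵖ) (f : L ⟶ M) (g : M ⟶ N),
      Function.Exact f.hom.hom g.hom.hom →
        Function.Exact ((GBP.coneFunctor.{u, v, w, x, y, z, m} π I i).map f).hom.hom
          ((GBP.coneFunctor.{u, v, w, x, y, z, m} π I i).map g).hom.hom := by
  have : IsNoetherianRing (A i)ᵐᵒᵖ := IsNoetherianRing.of_finite k _
  exact ⟨GBP.coneFunctor_exact π I i, fun L M N f g h =>
    GBP.bigConeFunctor_map_exact π I i f.hom g.hom h⟩
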